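/- Let $\mathbb F$ be a field. An algebraic circuit over $\mathbb F$ in $x_1,\dots,x_n$ is a finite directed acyclic graph (parallel edges allowed, unbounded fan-in) whose vertices of indegree $0$ (leaves) are labeled by variables or constants of $\mathbb F$ and whose other vertices are labeled $+$ or $\times$; it computes the polynomials at its output gates (vertices of outdegree $0$), and its size is its number of edges. It is syntactically multilinear if, at every product gate, the sets of variables occurring in the sub-circuits rooted at its inputs (one for each incoming edge) are pairwise disjoint. A $\Sigma\Pi\Sigma\Pi$ circuit is a circuit whose non-leaf gates form four layers, consisting, from the outputs down, of sum, product, sum and product gates, where each edge goes from the leaves to the bottom product layer or from one of the four layers to the next one above it. Let $\{f_n\}_{n\in\mathbb N}$ be a family (in particular, any explicit family) where $f_n\in\mathbb F[x_1,\dots,x_n]$ is a multilinear polynomial of degree $d=d(n)$ with $d=\omega(n/\log n)$. Suppose that every syntactically multilinear $\Sigma\Pi\Sigma\Pi$ circuit computing $f_n$ has size at least $n^{\Omega(\sqrt d)}$, that is, there is a constant $c>0$ such that for all sufficiently large $n$ every such circuit has size at least $n^{c\sqrt{d(n)}}$. Then $\{f_n\}$ requires syntactically multilinear circuits of superpolynomial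 size: for every $k\in\mathbb N$ and all sufficiently large $n$, every syntactically multilinear circuit computing $f_n$ has size greater than $n^k$. -/

import Mathlib

/-- The label of a gate of an algebraic circuit over `F` in the variables `x_0, …, x_{n-1}`:
a variable, a constant, a sum gate or a product gate. -/
inductive GateLabel (F : Type*) (n : ℕ) where
  | var (i : Fin n)
  | const (a : F)
  | add
  | mul

/-- A gate label that may stand at a leaf, that is, a variable or a constant. -/
def GateLabel.IsLeaf {F : Type*} {n : ℕ} : GateLabel F n → Prop
  | .var _ => True
  | .const _ => True
  | .add => False
  | .mul => False

/-- An algebraic circuit over `F` in `n` variables: a finite directed acyclic graph whose vertices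
of indegree zero carry variables or constants and whose other vertices carry `+` or `×`.
`inputs g` lists the gates wired into `g`, one entry for each edge, so parallel edges are allowed
and the fan-in is unbounded. -/
structure AlgCircuit (F : Type*) (n : ℕ) where
  Gate : Type
  fintypeGate : Fintype Gate
  label : Gate → GateLabel F n
  inputs : Gate → List Gate
  inputs_eq_nil_iff : ∀ g, inputs g = [] ↔ (label g).IsLeaf
  acyclic : ∀ g, ¬ Relation.TransGen (fun u v => u ∈ inputs v) g g

namespace AlgCircuit

attribute [instance] AlgCircuit.fintypeGate

variable {F : Type*} {n : ℕ}

/-- `C.Wire u v`: there is an edge from `u` into `v`. -/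
def Wire (C : AlgCircuit F n) (u v : C.Gate) : Prop := u ∈ C.inputs v

theorem wire_wf (C : AlgCircuit F n) : WellFounded C.Wire := by
  have : IsTrans C.Gate (Relation.TransGen C.Wire) := ⟨fun _ _ _ h k => h.trans k⟩
  have : Std.Irrefl (Relation.TransGen C.Wire) := ⟨C.acyclic⟩
  exact Subrelation.wf (fun h => Relation.TransGen.single h)
    (Finite.wellFounded_of_trans_of_irrefl (Relation.TransGen C.Wire))

/-- The size of a circuit is its number of edges. -/
def size (C : AlgCircuit F n) : ℕ := ∑ g : C.Gate, (C.inputs g).length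

/-- The polynomial computed at each gate. -/
noncomputable def value [CommSemiring F] (C : AlgCircuit F n) :
    C.Gate → MvPolynomial (Fin n) F :=
  C.wire_wf.fix fun g ih =>
    match C.label g with
    | .var i => MvPolynomial.X i
    | .const a => MvPolynomial.C a
    | .add => ((C.inputs g).attach.map fun u => ih u.1 u.2).sum
    | .mul => ((C.inputs g).attach.map fun u => ih u.1 u.2).prod

theorem value_eq [CommSemiring F] (C : AlgCircuit F n) (g : C.Gate) :
    C.value g =
      match C.label g with
      | .var i => MvPolynomial.X i
      | .const a => MvPolynomial.C a
      | .add => ((C.inputs g).map C.value).sum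
      | .mul => ((C.inputs g).map C.value).prod := by
  have h := C.wire_wf.fix_eq (C := fun _ => MvPolynomial (Fin n) F) (fun g ih =>
    match C.label g with
    | .var i => MvPolynomial.X i
    | .const a => MvPolynomial.C a
    | .add => ((C.inputs g).attach.map fun u => ih u.1 u.2).sum
    | .mul => ((C.inputs g).attach.map fun u => ih u.1 u.2).prod) g
  refine Eq.trans h ?_
  cases C.label g
  · rfl
  · rfl
  · exact congrArg List.sum (List.attach_map_val (l := C.inputs g) (f := C.value))
  · exact congrArg List.prod (List.attach_map_val (l := C.inputs g) (f := C.value))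

/-- The output gates are the gates of outdegree zero. -/
def IsOutput (C : AlgCircuit F n) (g : C.Gate) : Prop := ∀ v, ¬ C.Wire g v

/-- The circuit computes `p` if `p` is the polynomial at one of its output gates. -/
def Computes [CommSemiring F] (C : AlgCircuit F n) (p : MvPolynomial (Fin n) F) : Prop :=
  ∃ g, C.IsOutput g ∧ C.value g = p

/-- The (indices of the) variables that occur in the sub-circuit rooted at `g`. -/
def subVars (C : AlgCircuit F n) (g : C.Gate) : Set (Fin n) :=
  {i | ∃ u, Relation.ReflTransGen C.Wire u g ∧ C.label u = .var i}

/-- Syntactic multilinearity: the inputs of every product gate have sub-circuits on pairwise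
disjoint sets of variables. -/
def SyntacticallyMultilinear (C : AlgCircuit F n) : Prop :=
  ∀ g, C.label g = .mul →
    (C.inputs g).Pairwise fun u v => Disjoint (C.subVars u) (C.subVars v)

/-- A `ΣΠΣΠ` circuit: the leaves form layer `0`, the internal gates form four layers which from
the bottom up consist of products, sums, products, sums; edges run from each layer to the next,
and all outputs lie in the top layer. -/
def IsSigmaPiSigmaPi (C : AlgCircuit F n) : Prop :=
  ∃ layer : C.Gate → ℕ,
    (∀ g, (C.label g).IsLeaf → layer g = 0) ∧
    (∀ g, C.label g = .mul → layer g = 1 ∨ layer g = 3) ∧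
    (∀ g, C.label g = .add → layer g = 2 ∨ layer g = 4) ∧
    (∀ u v, C.Wire u v → layer v = layer u + 1) ∧
    (∀ g, C.IsOutput g → layer g = 4)

end AlgCircuit

/-! The engine is a depth reduction driven by the number of variables. Fix a threshold `t` and call
a gate heavy if more than `t` variables lie below it. From a heavy gate `a`, follow all inputs at
sum gates and one heavy input at product gates. Sorting the contributions by the heavy gate `u`
where the descent stops gives `val a = ∑ u, pathCoeff u a * lightPart u`
(`val_eq_sum_pathCoeff_mul`).

The factor `lightPart u` is a short sum of products of polynomials in at most `t` variables. By
syntactic multilinearity the factors left aside on the way to `u` avoid the variables of `u`, so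
`pathCoeff u a` has lost more than `t` variables. It is again the value of a gate in a syntactically
multilinear system with no more edges (`pathSystem`), hence the step can be iterated. With `E` edges
and `n ≤ (K + 1) * t`, after `K` rounds there are at most `E ^ K` products of polynomials in
disjoint sets of at most `t` variables (`isSumOfDisjointProducts_val`). Writing each factor as a sum
of at most `2 ^ t` monomials yields a `ΣΠΣΠ` circuit.

For `E = n ^ k`, `t ≈ √(n log n)` and `K = n / t`, its size is `exp (O(√(n log n)))`. Since `d = ω(n
/ log n)`, the assumed bound `n ^ (c √d)` equals `exp (ω(√(n log n)))`, a contradiction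
(`eventually_depthFour_size_lt`). -/

open MvPolynomial

/-- `p` is a linear combination of products of distinct variables from `W`. -/
def IsMultilinearOn {σ R : Type*} [DecidableEq σ] [CommSemiring R] (W : Finset σ)
    (p : MvPolynomial σ R) : Prop :=
  ∀ i, p.degreeOf i ≤ if i ∈ W then 1 else 0

/-! ### Multilinear polynomials -/

section Multilinear

variable {σ R : Type*} [DecidableEq σ] [CommSemiring R]

theorem IsMultilinearOn.mono {W W' : Finset σ} {p : MvPolynomial σ R}
    (h : IsMultilinearOn W p) (hW : W ⊆ W') : IsMultilinearOn W' p := by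
  intro i
  refine (h i).trans ?_
  by_cases hi : i ∈ W
  · simp [hi, hW hi]
  · simp [hi]

theorem isMultilinearOn_C (W : Finset σ) (a : R) : IsMultilinearOn W (C a) := by
  intro i
  simp [degreeOf_C]

theorem isMultilinearOn_zero (W : Finset σ) : IsMultilinearOn W (0 : MvPolynomial σ R) := by
  simpa using isMultilinearOn_C W (0 : R)

theorem isMultilinearOn_one (W : Finset σ) : IsMultilinearOn W (1 : MvPolynomial σ R) := by
  simpa using isMultilinearOn_C W (1 : R)

theorem isMultilinearOn_X {W : Finset σ} {i : σ} (hi : i ∈ W) :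
    IsMultilinearOn W (X i : MvPolynomial σ R) := by
  intro j
  have h : degreeOf j (X i : MvPolynomial σ R) ≤ if j = i then 1 else 0 := by
    cases subsingleton_or_nontrivial R
    · simp [Subsingleton.elim (X i : MvPolynomial σ R) 0]
    · rw [degreeOf_X]
  refine h.trans ?_
  by_cases hj : j = i
  · subst hj; simp [hi]
  · simp [hj]

theorem IsMultilinearOn.add {W : Finset σ} {p q : MvPolynomial σ R}
    (hp : IsMultilinearOn W p) (hq : IsMultilinearOn W q) : IsMultilinearOn W (p + q) :=
  fun i => (degreeOf_add_le i p q).trans (max_le (hp i) (hq i))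

theorem IsMultilinearOn.mul {W W' : Finset σ} {p q : MvPolynomial σ R} (hd : Disjoint W W')
    (hp : IsMultilinearOn W p) (hq : IsMultilinearOn W' q) :
    IsMultilinearOn (W ∪ W') (p * q) := by
  intro i
  refine (degreeOf_mul_le i p q).trans ((add_le_add (hp i) (hq i)).trans ?_)
  by_cases hi : i ∈ W
  · have : i ∉ W' := Finset.disjoint_left.mp hd hi
    simp [hi, this]
  · simp [hi]

theorem isMultilinearOn_list_sum {W : Finset σ} {l : List (MvPolynomial σ R)}
    (h : ∀ p ∈ l, IsMultilinearOn W p) : IsMultilinearOn W l.sum := by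
  induction l with
  | nil => simpa using isMultilinearOn_zero W
  | cons p l ih =>
    rw [List.sum_cons]
    exact (h p (by simp)).add (ih fun q hq => h q (by simp [hq]))

theorem isMultilinearOn_list_prod {ι : Type*} {W : Finset σ} {V : ι → Finset σ}
    {f : ι → MvPolynomial σ R} {l : List ι} (h : ∀ a ∈ l, IsMultilinearOn (V a) (f a))
    (hW : ∀ a ∈ l, V a ⊆ W) (hd : l.Pairwise fun a b => Disjoint (V a) (V b)) :
    IsMultilinearOn W (l.map f).prod := by
  induction l generalizing W with
  | nil => simpa using isMultilinearOn_one W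
  | cons a l ih =>
    rw [List.map_cons, List.prod_cons]
    rw [List.pairwise_cons] at hd
    -- The ambient set shrinks at each factor, so that the remaining product is disjoint from the
    -- first one.
    have h1 := ih (W := W \ V a) (fun b hb => h b (by simp [hb]))
      (fun b hb => Finset.subset_sdiff.mpr ⟨hW b (by simp [hb]), (hd.1 b hb).symm⟩) hd.2
    exact ((h a (by simp)).mul Finset.disjoint_sdiff h1).mono
      (Finset.union_subset (hW a (by simp)) Finset.sdiff_subset)

/-- Exponents of a multilinear polynomial are 0 or 1, so each exponent vector in the support is the
indicator of its own support, a subset of `W`. This supplies the two bottom layers of the depth-four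
circuit. -/
theorem IsMultilinearOn.eq_sum_powerset {W : Finset σ} {p : MvPolynomial σ R}
    (h : IsMultilinearOn W p) :
    p = ∑ S ∈ W.powerset, C (coeff (∑ i ∈ S, Finsupp.single i 1) p) * ∏ i ∈ S, X i := by
  have hsum : ∀ (S : Finset σ) (j : σ),
      (∑ i ∈ S, Finsupp.single i 1 : σ →₀ ℕ) j = if j ∈ S then 1 else 0 := by
    intro S j
    rw [Finsupp.finsetSum_apply]
    simp [Finsupp.single_apply]
  have hinj : Function.Injective (fun S : Finset σ => (∑ i ∈ S, Finsupp.single i 1 : σ →₀ ℕ)) := by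
    intro S T hST
    ext j
    have := DFunLike.congr_fun hST j
    simp only [hsum] at this
    by_cases h1 : j ∈ S <;> by_cases h2 : j ∈ T <;> simp_all
  have hsub : p.support ⊆
      W.powerset.image (fun S => (∑ i ∈ S, Finsupp.single i 1 : σ →₀ ℕ)) := by
    intro m hm
    have hm' : ∀ i, m i ≤ if i ∈ W then 1 else 0 :=
      fun i => (monomial_le_degreeOf i hm).trans (h i)
    refine Finset.mem_image.mpr ⟨m.support, ?_, ?_⟩
    · rw [Finset.mem_powerset]
      intro i hi
      by_contra hiW
      have := hm' i
      simp_all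
    · ext j
      rw [hsum]
      have := hm' j
      by_cases hj : j ∈ m.support
      · have h0 : m j ≠ 0 := Finsupp.mem_support_iff.mp hj
        split_ifs at this ⊢ <;> omega
      · simp only [hj, if_false]
        exact (Finsupp.notMem_support_iff.mp hj).symm
  conv_lhs => rw [p.as_sum]
  rw [Finset.sum_subset hsub (fun m _ hm => by
    rw [notMem_support_iff.mp hm, monomial_zero]), Finset.sum_image hinj.injOn]
  exact Finset.sum_congr rfl fun S _ => monomial_sum_index _ _ _

/-! ### Sums of products over disjoint sets of variables -/

/-- `p` is a product of at most `M` polynomials that are multilinear on pairwise disjoint subsets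
of `W`, each with at most `t` elements. -/
def IsDisjointProduct (t M : ℕ) (W : Finset σ) (p : MvPolynomial σ R) : Prop :=
  ∃ l : List (Finset σ × MvPolynomial σ R), l.length ≤ M ∧
    (l.Pairwise fun x y => Disjoint x.1 y.1) ∧
    (∀ x ∈ l, x.1.card ≤ t ∧ x.1 ⊆ W ∧ IsMultilinearOn x.1 x.2) ∧ (l.map Prod.snd).prod = p

/-- `p` is a sum of at most `N` polynomials satisfying `IsDisjointProduct t M W`. -/
def IsSumOfDisjointProducts (t N M : ℕ) (W : Finset σ) (p : MvPolynomial σ R) : Prop :=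
  ∃ L : List (MvPolynomial σ R), L.length ≤ N ∧ (∀ q ∈ L, IsDisjointProduct t M W q) ∧ L.sum = p

variable {t N N' M M' : ℕ} {W W' : Finset σ} {p q : MvPolynomial σ R}

theorem IsDisjointProduct.mono (h : IsDisjointProduct t M W p) (hM : M ≤ M') (hW : W ⊆ W') :
    IsDisjointProduct t M' W' p := by
  obtain ⟨l, h1, h2, h3, h4⟩ := h
  exact ⟨l, h1.trans hM, h2, fun x hx => ⟨(h3 x hx).1, (h3 x hx).2.1.trans hW, (h3 x hx).2.2⟩, h4⟩

theorem IsDisjointProduct.mul (hp : IsDisjointProduct t M W p) (hq : IsDisjointProduct t M' W' q)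
    (hd : Disjoint W W') : IsDisjointProduct t (M + M') (W ∪ W') (p * q) := by
  obtain ⟨l, h1, h2, h3, rfl⟩ := hp
  obtain ⟨l', h1', h2', h3', rfl⟩ := hq
  refine ⟨l ++ l', ?_, ?_, ?_, by simp⟩
  · simpa using add_le_add h1 h1'
  · rw [List.pairwise_append]
    exact ⟨h2, h2', fun x hx y hy => hd.mono (h3 x hx).2.1 (h3' y hy).2.1⟩
  · intro x hx
    rcases List.mem_append.mp hx with hx | hx
    · exact ⟨(h3 x hx).1, (h3 x hx).2.1.trans Finset.subset_union_left, (h3 x hx).2.2⟩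
    · exact ⟨(h3' x hx).1, (h3' x hx).2.1.trans Finset.subset_union_right, (h3' x hx).2.2⟩

theorem IsMultilinearOn.isDisjointProduct (h : IsMultilinearOn W p) (ht : W.card ≤ t) :
    IsDisjointProduct t 1 W p :=
  ⟨[(W, p)], by simp, by simp, by simp [ht, h], by simp⟩

theorem isDisjointProduct_list_prod {ι : Type*} {V : ι → Finset σ}
    {f : ι → MvPolynomial σ R} {l : List ι} (h : ∀ a ∈ l, IsMultilinearOn (V a) (f a))
    (ht : ∀ a ∈ l, (V a).card ≤ t)
    (hW : ∀ a ∈ l, V a ⊆ W) (hd : l.Pairwise fun a b => Disjoint (V a) (V b)) :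
    IsDisjointProduct t l.length W (l.map f).prod := by
  refine ⟨l.map fun a => (V a, f a), by simp, ?_, ?_, by simp [Function.comp_def]⟩
  · rwa [List.pairwise_map]
  · intro x hx
    obtain ⟨a, ha, rfl⟩ := List.mem_map.mp hx
    exact ⟨ht a ha, hW a ha, h a ha⟩

theorem IsDisjointProduct.isSumOfDisjointProducts (h : IsDisjointProduct t M W p) :
    IsSumOfDisjointProducts t 1 M W p :=
  ⟨[p], by simp, by simpa using h, by simp⟩

theorem isSumOfDisjointProducts_zero (t N M : ℕ) (W : Finset σ) :
    IsSumOfDisjointProducts t N M W (0 : MvPolynomial σ R) :=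
  ⟨[], by simp, by simp, by simp⟩

theorem IsSumOfDisjointProducts.mono (h : IsSumOfDisjointProducts t N M W p) (hN : N ≤ N')
    (hM : M ≤ M') (hW : W ⊆ W') : IsSumOfDisjointProducts t N' M' W' p := by
  obtain ⟨L, h1, h2, h3⟩ := h
  exact ⟨L, h1.trans hN, fun q hq => (h2 q hq).mono hM hW, h3⟩

theorem IsSumOfDisjointProducts.add (hp : IsSumOfDisjointProducts t N M W p)
    (hq : IsSumOfDisjointProducts t N' M W q) :
    IsSumOfDisjointProducts t (N + N') M W (p + q) := by
  obtain ⟨L, h1, h2, rfl⟩ := hp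
  obtain ⟨L', h1', h2', rfl⟩ := hq
  refine ⟨L ++ L', by simpa using add_le_add h1 h1', ?_, by simp⟩
  intro x hx
  rcases List.mem_append.mp hx with hx | hx
  exacts [h2 x hx, h2' x hx]

theorem isSumOfDisjointProducts_sum {ι : Type*} {s : Finset ι} {N : ι → ℕ}
    {f : ι → MvPolynomial σ R} (h : ∀ a ∈ s, IsSumOfDisjointProducts t (N a) M W (f a)) :
    IsSumOfDisjointProducts t (∑ a ∈ s, N a) M W (∑ a ∈ s, f a) := by
  classical
  induction s using Finset.induction_on with
  | empty => simpa using isSumOfDisjointProducts_zero t 0 M W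
  | insert a s ha ih =>
    rw [Finset.sum_insert ha, Finset.sum_insert ha]
    exact (h a (by simp)).add (ih fun b hb => h b (by simp [hb]))

theorem IsDisjointProduct.mul_list_sum (hp : IsDisjointProduct t M W p)
    (hq : IsSumOfDisjointProducts t N M' W' q) (hd : Disjoint W W') :
    IsSumOfDisjointProducts t N (M + M') (W ∪ W') (p * q) := by
  obtain ⟨L, h1, h2, rfl⟩ := hq
  refine ⟨L.map (p * ·), by simpa using h1, ?_, ?_⟩
  · intro x hx
    obtain ⟨a, ha, rfl⟩ := List.mem_map.mp hx
    exact hp.mul (h2 a ha) hd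
  · rw [List.sum_map_mul_left]; simp

theorem IsSumOfDisjointProducts.mul (hp : IsSumOfDisjointProducts t N M W p)
    (hq : IsSumOfDisjointProducts t N' M' W' q) (hd : Disjoint W W') :
    IsSumOfDisjointProducts t (N * N') (M + M') (W ∪ W') (p * q) := by
  obtain ⟨L, h1, h2, rfl⟩ := hp
  have key : ∀ L : List (MvPolynomial σ R), (∀ x ∈ L, IsDisjointProduct t M W x) →
      IsSumOfDisjointProducts t (L.length * N') (M + M') (W ∪ W') (L.sum * q) := by
    intro L hL
    induction L with
    | nil => simpa using isSumOfDisjointProducts_zero t _ _ _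
    | cons x L ih =>
      have := ((hL x (by simp)).mul_list_sum hq hd).add (ih fun y hy => hL y (by simp [hy]))
      rw [List.sum_cons, add_mul]
      exact this.mono (by rw [List.length_cons]; linarith) le_rfl subset_rfl
  exact (key L h2).mono (Nat.mul_le_mul_right _ h1) le_rfl subset_rfl

end Multilinear

/-! ### Heavy gates and the path decomposition -/

/-- The kinds of gates of a `MultilinearSystem`. -/
inductive GateKind where
  | leaf
  | sum
  | prod

/-- A syntactically multilinear circuit, given by the polynomials `val` at its gates and by sets
`vars` that contain the variables below them. Leaves may carry any multilinear polynomial in at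
most `t` variables. -/
structure MultilinearSystem (σ R G : Type*) [DecidableEq σ] [CommSemiring R] (t : ℕ) where
  kind : G → GateKind
  inputs : G → List G
  val : G → MvPolynomial σ R
  vars : G → Finset σ
  rank : G → ℕ
  rank_lt : ∀ a, ∀ b ∈ inputs a, rank b < rank a
  vars_subset : ∀ a, ∀ b ∈ inputs a, vars b ⊆ vars a
  card_leaf : ∀ a, kind a = .leaf → (vars a).card ≤ t
  val_leaf : ∀ a, kind a = .leaf → IsMultilinearOn (vars a) (val a)
  val_sum : ∀ a, kind a = .sum → val a = ((inputs a).map val).sum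
  val_prod : ∀ a, kind a = .prod → val a = ((inputs a).map val).prod
  inputs_ne_nil : ∀ a, kind a = .prod → inputs a ≠ []
  disjoint : ∀ a, kind a = .prod → (inputs a).Pairwise fun b c => Disjoint (vars b) (vars c)

namespace MultilinearSystem

variable {σ R G : Type*} [DecidableEq σ] [CommSemiring R] {t : ℕ}
  (S : MultilinearSystem σ R G t)

theorem isMultilinearOn_val (a : G) : IsMultilinearOn (S.vars a) (S.val a) := by
  induction h : S.rank a using Nat.strong_induction_on generalizing a with
  | _ r ih =>
    subst h
    have ih' : ∀ b ∈ S.inputs a, IsMultilinearOn (S.vars b) (S.val b) :=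
      fun b hb => ih _ (S.rank_lt a b hb) b rfl
    cases hk : S.kind a with
    | leaf => exact S.val_leaf a hk
    | sum =>
      rw [S.val_sum a hk]
      refine isMultilinearOn_list_sum fun p hp => ?_
      obtain ⟨b, hb, rfl⟩ := List.mem_map.mp hp
      exact (ih' b hb).mono (S.vars_subset a b hb)
    | prod =>
      rw [S.val_prod a hk]
      exact isMultilinearOn_list_prod ih' (S.vars_subset a) (S.disjoint a hk)

/-- The first input with more than `t` variables. -/
def heavyInput (a : G) : Option G :=
  (S.inputs a).find? fun b => decide (t < (S.vars b).card)

variable {S} in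
theorem mem_of_heavyInput {a c : G} (h : S.heavyInput a = some c) : c ∈ S.inputs a :=
  List.mem_of_find?_eq_some h

variable {S} in
theorem lt_card_of_heavyInput {a c : G} (h : S.heavyInput a = some c) :
    t < (S.vars c).card := by
  simpa using List.find?_some h

variable {S} in
theorem card_le_of_heavyInput {a : G} (h : S.heavyInput a = none) :
    ∀ b ∈ S.inputs a, (S.vars b).card ≤ t := by
  intro b hb
  simpa using List.find?_eq_none.mp h b hb

/-- `S.Below u a`: the gate `u` lies in the sub-circuit rooted at `a`. -/
def Below (u a : G) : Prop := Relation.ReflTransGen (fun b c => b ∈ S.inputs c) u a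

variable {S} in
theorem Below.vars_subset {u a : G} (h : S.Below u a) : S.vars u ⊆ S.vars a := by
  induction h with
  | refl => exact subset_rfl
  | tail _ hb ih => exact ih.trans (S.vars_subset _ _ hb)

variable {S} in
theorem Below.of_mem {u a b : G} (h : S.Below u b) (hb : b ∈ S.inputs a) : S.Below u a :=
  Relation.ReflTransGen.tail h hb

/-- The part of the value of `u` that does not come from inputs with more than `t` variables. -/
noncomputable def lightPart (u : G) : MvPolynomial σ R :=
  match S.kind u with
  | .leaf => 0
  | .sum => (((S.inputs u).filter fun b => (S.vars b).card ≤ t).map S.val).sum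
  | .prod =>
    match S.heavyInput u with
    | none => ((S.inputs u).map S.val).prod
    -- A product with a heavy input is accounted for entirely by the paths through that input.
    | some _ => 0

theorem isSumOfDisjointProducts_lightPart {u : G} :
    IsSumOfDisjointProducts t (S.inputs u).length (S.inputs u).length (S.vars u)
      (S.lightPart u) := by
  cases hk : S.kind u with
  | leaf => simpa [lightPart, hk] using isSumOfDisjointProducts_zero _ _ _ _
  | sum =>
    simp only [lightPart, hk]
    refine ⟨_, (by simpa using List.length_filter_le _ _), fun q hq => ?_, rfl⟩
    obtain ⟨b, hb, rfl⟩ := List.mem_map.mp hq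
    rw [List.mem_filter] at hb
    exact ((S.isMultilinearOn_val b).isDisjointProduct (by simpa using hb.2)).mono
      (List.length_pos_of_mem hb.1) (S.vars_subset u b hb.1)
  | prod =>
    cases hc : S.heavyInput u with
    | none =>
      simp only [lightPart, hk, hc]
      refine (isDisjointProduct_list_prod (fun b _ => S.isMultilinearOn_val b)
        (card_le_of_heavyInput hc) (S.vars_subset u)
        (S.disjoint u hk)).isSumOfDisjointProducts.mono ?_ le_rfl subset_rfl
      exact List.length_pos_of_ne_nil (S.inputs_ne_nil u hk)
    | some c => simpa [lightPart, hk, hc] using isSumOfDisjointProducts_zero _ _ _ _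

variable [DecidableEq G]

/-- The sum, over all paths from `a` down to `u` that follow the heavy input at every product
gate, of the products of the values of the inputs that are left aside. -/
noncomputable def pathCoeff (u a : G) : MvPolynomial σ R :=
  if a = u then 1
  -- Paths never enter a light gate: its value already belongs to the light part of a sum gate or to
  -- the factors left aside at a product gate.
  else if (S.vars a).card ≤ t then 0
  else match S.kind a with
    | .leaf => 0
    | .sum => ((S.inputs a).attach.map fun b => pathCoeff u b.1).sum
    | .prod =>
      match _h : S.heavyInput a with
      | none => 0
      | some c => pathCoeff u c * (((S.inputs a).erase c).map S.val).prod
termination_by S.rank a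
decreasing_by
  · exact S.rank_lt a b.1 b.2
  · exact S.rank_lt a c (mem_of_heavyInput _h)

@[simp]
theorem pathCoeff_self (u : G) : S.pathCoeff u u = 1 := by
  rw [pathCoeff, if_pos rfl]

theorem pathCoeff_of_card_le {u a : G} (h : a ≠ u) (ha : (S.vars a).card ≤ t) :
    S.pathCoeff u a = 0 := by
  rw [pathCoeff, if_neg h, if_pos ha]

theorem pathCoeff_sum {u a : G} (h : a ≠ u) (ha : t < (S.vars a).card) (hk : S.kind a = .sum) :
    S.pathCoeff u a = ((S.inputs a).map (S.pathCoeff u)).sum := by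
  rw [pathCoeff, if_neg h, if_neg ha.not_ge, hk]
  simp only
  rw [List.attach_map_val (l := S.inputs a) (f := S.pathCoeff u)]

theorem pathCoeff_prod_none {u a : G} (h : a ≠ u) (hk : S.kind a = .prod)
    (hc : S.heavyInput a = none) : S.pathCoeff u a = 0 := by
  rw [pathCoeff, if_neg h, hk]
  simp only
  split_ifs
  · rfl
  · split
    · rfl
    · simp_all

theorem pathCoeff_prod_some {u a c : G} (h : a ≠ u) (ha : t < (S.vars a).card)
    (hk : S.kind a = .prod) (hc : S.heavyInput a = some c) :
    S.pathCoeff u a = S.pathCoeff u c * (((S.inputs a).erase c).map S.val).prod := by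
  rw [pathCoeff, if_neg h, if_neg ha.not_ge, hk]
  simp only
  split
  · simp_all
  · simp_all

theorem pathCoeff_eq_zero_of_rank_lt {u a : G} (h : S.rank a < S.rank u) :
    S.pathCoeff u a = 0 := by
  induction hr : S.rank a using Nat.strong_induction_on generalizing a with
  | _ r ih =>
    subst hr
    have hau : a ≠ u := by rintro rfl; exact lt_irrefl _ h
    have ih' : ∀ b ∈ S.inputs a, S.pathCoeff u b = 0 := fun b hb =>
      ih _ (S.rank_lt a b hb) ((S.rank_lt a b hb).trans h) rfl
    by_cases ha : (S.vars a).card ≤ t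
    · exact S.pathCoeff_of_card_le hau ha
    push Not at ha
    cases hk : S.kind a with
    | leaf => exact absurd (S.card_leaf a hk) ha.not_ge
    | sum =>
      rw [S.pathCoeff_sum hau ha hk]
      refine List.sum_eq_zero fun p hp => ?_
      obtain ⟨b, hb, rfl⟩ := List.mem_map.mp hp
      exact ih' b hb
    | prod =>
      cases hc : S.heavyInput a with
      | none => exact S.pathCoeff_prod_none hau hk hc
      | some c =>
        rw [S.pathCoeff_prod_some hau ha hk hc, ih' c (mem_of_heavyInput hc), zero_mul]

theorem pathCoeff_eq_zero_of_not_below {u a : G} (h : ¬ S.Below u a) :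
    S.pathCoeff u a = 0 := by
  induction hr : S.rank a using Nat.strong_induction_on generalizing a with
  | _ r ih =>
    subst hr
    have hau : a ≠ u := by rintro rfl; exact h Relation.ReflTransGen.refl
    have ih' : ∀ b ∈ S.inputs a, S.pathCoeff u b = 0 := fun b hb =>
      ih _ (S.rank_lt a b hb) (fun hub => h (hub.of_mem hb)) rfl
    by_cases ha : (S.vars a).card ≤ t
    · exact S.pathCoeff_of_card_le hau ha
    push Not at ha
    cases hk : S.kind a with
    | leaf => exact absurd (S.card_leaf a hk) ha.not_ge
    | sum =>
      rw [S.pathCoeff_sum hau ha hk]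
      refine List.sum_eq_zero fun p hp => ?_
      obtain ⟨b, hb, rfl⟩ := List.mem_map.mp hp
      exact ih' b hb
    | prod =>
      cases hc : S.heavyInput a with
      | none => exact S.pathCoeff_prod_none hau hk hc
      | some c =>
        rw [S.pathCoeff_prod_some hau ha hk hc, ih' c (mem_of_heavyInput hc), zero_mul]

/-- Induction down the circuit. At `a` the term `u = a` contributes `lightPart a` with coefficient
1; for every other `u` the recursion of `pathCoeff` mirrors that of the value, and the inputs supply
the rest by induction. -/
theorem val_eq_sum_pathCoeff_mul [Fintype G] {a : G} (ha : t < (S.vars a).card) :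
    S.val a = ∑ u with t < (S.vars u).card, S.pathCoeff u a * S.lightPart u := by
  induction hr : S.rank a using Nat.strong_induction_on generalizing a with
  | _ r ih =>
    subst hr
    set B : Finset G := Finset.univ.filter fun u => t < (S.vars u).card with hB
    have haB : a ∈ B := by simp [hB, ha]
    -- Light inputs give 0 here because every `u` in `B` is heavy; their values reappear in
    -- `lightPart a`.
    have hrec : ∀ b ∈ S.inputs a, ∑ u ∈ B, S.pathCoeff u b * S.lightPart u =
        if (S.vars b).card ≤ t then 0 else S.val b := by
      intro b hb
      split_ifs with hbt
      · refine Finset.sum_eq_zero fun u hu => ?_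
        rw [S.pathCoeff_of_card_le _ hbt, zero_mul]
        rintro rfl
        simp [hB, hbt.not_gt] at hu
      · exact (ih _ (S.rank_lt a b hb) (not_le.mp hbt) rfl).symm
    have hself : ∀ b ∈ S.inputs a, S.pathCoeff a b = 0 := fun b hb =>
      S.pathCoeff_eq_zero_of_rank_lt (S.rank_lt a b hb)
    -- it suffices to split off the term of `a` itself
    have hsplit : ∀ g : G → MvPolynomial σ R, g a = 0 →
        (∀ u, a ≠ u → S.pathCoeff u a = g u) →
        ∑ u ∈ B, S.pathCoeff u a * S.lightPart u =
          S.lightPart a + ∑ u ∈ B, g u * S.lightPart u := by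
      intro g hg h
      rw [← Finset.add_sum_erase B _ haB, ← Finset.add_sum_erase B (fun u => g u * _) haB, hg,
        pathCoeff_self, one_mul, zero_mul, zero_add]
      congr 1
      refine Finset.sum_congr rfl fun u hu => ?_
      rw [h u (Finset.ne_of_mem_erase hu).symm]
    cases hk : S.kind a with
    | leaf => exact absurd (S.card_leaf a hk) ha.not_ge
    | sum =>
      rw [hsplit (fun u => ((S.inputs a).map (S.pathCoeff u)).sum) ?_
        fun u hu => S.pathCoeff_sum hu ha hk]
      · rw [S.val_sum a hk, lightPart, hk]
        simp only
        have key : ∀ l : List G, (∀ b ∈ l, b ∈ S.inputs a) → (l.map S.val).sum =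
            ((l.filter fun b => (S.vars b).card ≤ t).map S.val).sum +
              ∑ u ∈ B, (l.map (S.pathCoeff u)).sum * S.lightPart u := by
          intro l hl
          induction l with
          | nil => simp
          | cons b l ihl =>
            simp only [List.map_cons, List.sum_cons, add_mul, Finset.sum_add_distrib]
            rw [hrec b (hl b (by simp)), ihl fun c hc => hl c (by simp [hc])]
            by_cases hbt : (S.vars b).card ≤ t
            · simp [hbt, add_assoc]
            · simp only [List.filter_cons, hbt, decide_false, if_false, Bool.false_eq_true]
              ring
        exact key _ fun _ h => h
      · refine List.sum_eq_zero fun p hp => ?_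
        obtain ⟨b, hb, rfl⟩ := List.mem_map.mp hp
        exact hself b hb
    | prod =>
      cases hc : S.heavyInput a with
      | none =>
        rw [hsplit (fun _ => 0) rfl fun u hu => S.pathCoeff_prod_none hu hk hc]
        simp [S.val_prod a hk, lightPart, hk, hc]
      | some c =>
        have hcm := mem_of_heavyInput hc
        rw [hsplit (fun u => S.pathCoeff u c * (((S.inputs a).erase c).map S.val).prod) ?_
          fun u hu => S.pathCoeff_prod_some hu ha hk hc]
        · have h1 : S.lightPart a = 0 := by simp [lightPart, hk, hc]
          have h2 := hrec c hcm
          rw [if_neg (lt_card_of_heavyInput hc).not_ge] at h2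
          rw [h1, zero_add, S.val_prod a hk,
            ((List.perm_cons_erase hcm).map S.val).prod_eq, List.map_cons, List.prod_cons, ← h2,
            Finset.sum_mul]
          exact Finset.sum_congr rfl fun u _ => mul_right_comm _ _ _
        · rw [hself c hcm, zero_mul]

/-! ### Path coefficients as values of a smaller system -/

theorem disjoint_of_mem_erase {a b c : G} (hk : S.kind a = .prod) (hc : c ∈ S.inputs a)
    (hb : b ∈ (S.inputs a).erase c) : Disjoint (S.vars c) (S.vars b) := by
  have h := (List.Perm.pairwise_iff (fun h => Disjoint.symm h)
    (List.perm_cons_erase hc)).mp (S.disjoint a hk)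
  exact (List.pairwise_cons.mp h).1 b hb

variable {S} in
omit [DecidableEq G] in
-- A heavy `u` has a variable, so it cannot lie below two inputs of one product gate. Hence the
-- inputs left aside on a path to `u` keep their original values in `pathSystem`.
theorem Below.not_below_of_disjoint {u b c : G} (hc : S.Below u c)
    (hu : t < (S.vars u).card) (h : Disjoint (S.vars c) (S.vars b)) : ¬ S.Below u b := by
  intro hb
  have h0 := Finset.subset_empty.mp (h hc.vars_subset hb.vars_subset)
  simp [h0] at hu

open Classical in
/-- The system whose value at the gates `a` above `u` is `S.pathCoeff u a`. It has no more edges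
than `S`, and the variables of `u` no longer occur at the gates above `u`. -/
noncomputable def pathSystem (u : G) (hu : t < (S.vars u).card) :
    MultilinearSystem σ R G t where
  -- The gate `u` becomes a leaf of value 1. A product gate above `u` whose heavy input does not
  -- lead to `u` has coefficient 0 and becomes an empty sum, since products must have inputs.
  kind a := if S.Below u a then
      if a = u then .leaf
      else if S.kind a = .prod ∧ ∀ c, S.heavyInput a = some c → ¬ S.Below u c then .sum
      else S.kind a
    else S.kind a
  -- Sum gates keep only inputs above `u`: the others have coefficient 0, but in the new system they
  -- carry their old values and possibly variables of `u`.
  inputs a := if S.Below u a then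
      if a = u then []
      else if S.kind a = .prod then
        match S.heavyInput a with
        | none => []
        | some c => if S.Below u c then S.inputs a else []
      else (S.inputs a).filter fun b => S.Below u b
    else S.inputs a
  val a := if S.Below u a then S.pathCoeff u a else S.val a
  vars a := if S.Below u a then S.vars a \ S.vars u else S.vars a
  rank := S.rank
  rank_lt a b hb := by
    refine S.rank_lt a b ?_
    split_ifs at hb
    · simp at hb
    · split at hb
      · simp at hb
      · split_ifs at hb
        · exact hb
        · simp at hb
    · exact List.mem_of_mem_filter hb
    · exact hb
  vars_subset a b hb := by
    have hba : b ∈ S.inputs a := by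
      split_ifs at hb
      · simp at hb
      · split at hb
        · simp at hb
        · split_ifs at hb
          · exact hb
          · simp at hb
      · exact List.mem_of_mem_filter hb
      · exact hb
    have := S.vars_subset a b hba
    by_cases hb' : S.Below u b
    · have ha' := hb'.of_mem hba
      simp only [hb', ha', if_true]
      exact Finset.sdiff_subset_sdiff this subset_rfl
    · simp only [hb', if_false]
      by_cases ha' : S.Below u a
      · simp only [ha', if_true] at hb ⊢
        split_ifs at hb with h1 h2
        · simp at hb
        · split at hb
          · simp at hb
          · rename_i c hc
            split_ifs at hb with h3
            · have hne : c ≠ b := by rintro rfl; exact hb' h3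
              have hk : S.kind a = .prod := by assumption
              have hd := S.disjoint_of_mem_erase hk (mem_of_heavyInput hc)
                ((List.mem_erase_of_ne hne.symm).mpr hba)
              exact Finset.subset_sdiff.mpr ⟨this, (hd.mono_left h3.vars_subset).symm⟩
            · simp at hb
        · simp [hb'] at hb
      · simpa [ha'] using this
  card_leaf a ha := by
    split_ifs at ha ⊢ with h1 h2 h3
    · simp [h2]
    · exact (Finset.card_le_card Finset.sdiff_subset).trans (S.card_leaf a ha)
    · exact S.card_leaf a ha
  val_leaf a ha := by
    split_ifs at ha ⊢ with h1 h2 h3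
    · rw [h2, pathCoeff_self]
      exact isMultilinearOn_one _
    · rw [S.pathCoeff_of_card_le h2 (S.card_leaf a ha)]
      exact isMultilinearOn_zero _
    · exact S.val_leaf a ha
  val_sum a ha := by
    by_cases h1 : S.Below u a
    · have hau := hu.trans_le (Finset.card_le_card h1.vars_subset)
      by_cases h2 : a = u
      · subst h2; simp [h1] at ha
      · by_cases hk : S.kind a = .prod
        · cases hc : S.heavyInput a with
          | none => simp [h1, h2, hk, S.pathCoeff_prod_none h2 hk hc]
          | some c =>
            by_cases hcu : S.Below u c
            · simp [h1, h2, hk, hc, hcu] at ha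
            · simp [h1, h2, hk, hcu, S.pathCoeff_prod_some h2 hau hk hc,
                S.pathCoeff_eq_zero_of_not_below hcu]
        · simp only [h1, h2, hk, if_true, if_false, false_and] at ha ⊢
          rw [S.pathCoeff_sum h2 hau ha]
          generalize S.inputs a = l
          induction l with
          | nil => simp
          | cons b l ih =>
            by_cases hb : S.Below u b
            · simp [hb, ih]
            · simp [hb, ih, S.pathCoeff_eq_zero_of_not_below hb]
    · simp only [h1, if_false] at ha ⊢
      rw [S.val_sum a ha]
      congr 1
      refine List.map_congr_left fun b hb => ?_
      rw [if_neg fun h => h1 (h.of_mem hb)]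
  val_prod a ha := by
    by_cases h1 : S.Below u a
    · have hau := hu.trans_le (Finset.card_le_card h1.vars_subset)
      by_cases h2 : a = u
      · subst h2; simp [h1] at ha
      · by_cases hk : S.kind a = .prod
        · cases hc : S.heavyInput a with
          | none => simp [h1, h2, hk, hc] at ha
          | some c =>
            by_cases hcu : S.Below u c
            · have hcm := mem_of_heavyInput hc
              simp only [h1, h2, hk, hcu, if_true, if_false]
              rw [S.pathCoeff_prod_some h2 hau hk hc,
                ((List.perm_cons_erase hcm).map _).prod_eq, List.map_cons, List.prod_cons,
                if_pos hcu]
              congr 2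
              refine List.map_congr_left fun b hb => ?_
              rw [if_neg (hcu.not_below_of_disjoint hu (S.disjoint_of_mem_erase hk hcm hb))]
            · simp [h1, h2, hk, hc, hcu] at ha
        · simp [h1, h2, hk] at ha
    · simp only [h1, if_false] at ha ⊢
      rw [S.val_prod a ha]
      congr 1
      refine List.map_congr_left fun b hb => ?_
      rw [if_neg fun h => h1 (h.of_mem hb)]
  inputs_ne_nil a ha := by
    by_cases h1 : S.Below u a
    · by_cases h2 : a = u
      · subst h2; simp [h1] at ha
      · by_cases hk : S.kind a = .prod
        · cases hc : S.heavyInput a with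
          | none => simp [h1, h2, hk, hc] at ha
          | some c =>
            by_cases hcu : S.Below u c
            · simpa [h1, h2, hk, hcu] using S.inputs_ne_nil a hk
            · simp [h1, h2, hk, hc, hcu] at ha
        · simp [h1, h2, hk] at ha
    · simp only [h1, if_false] at ha ⊢
      exact S.inputs_ne_nil a ha
  disjoint a ha := by
    have hkey : ∀ l : List G, (l.Pairwise fun b c => Disjoint (S.vars b) (S.vars c)) →
        l.Pairwise fun b c =>
          Disjoint (if S.Below u b then S.vars b \ S.vars u else S.vars b)
            (if S.Below u c then S.vars c \ S.vars u else S.vars c) := by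
      intro l hl
      refine hl.imp fun {b c} h => h.mono ?_ ?_
      · split_ifs
        exacts [Finset.sdiff_subset, subset_rfl]
      · split_ifs
        exacts [Finset.sdiff_subset, subset_rfl]
    apply hkey
    split_ifs at ha ⊢ with h1 h2 h3 h4
    · split
      · simp
      · split_ifs
        · exact S.disjoint a ha
        · simp
    · exact absurd ha ‹_›
    · exact S.disjoint a ha

theorem val_pathSystem {u a : G} (hu : t < (S.vars u).card) (h : S.Below u a) :
    (S.pathSystem u hu).val a = S.pathCoeff u a := by
  simp [pathSystem, h]

theorem vars_pathSystem {u a : G} (hu : t < (S.vars u).card) (h : S.Below u a) :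
    (S.pathSystem u hu).vars a = S.vars a \ S.vars u := by
  simp [pathSystem, h]

theorem length_inputs_pathSystem_le {u : G} (hu : t < (S.vars u).card) (a : G) :
    ((S.pathSystem u hu).inputs a).length ≤ (S.inputs a).length := by
  simp only [pathSystem]
  split_ifs
  · simp
  · split
    · simp
    · split_ifs <;> simp
  · exact List.length_filter_le _ _
  · rfl

/-- The value of a gate with at most `(K + 1) t` variables in a system with at most `E` edges is
a sum of at most `E ^ K` products of polynomials in at most `t` variables each. -/
theorem isSumOfDisjointProducts_val [Fintype G] {E : ℕ} (hE : 1 ≤ E) (K : ℕ)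
    (S : MultilinearSystem σ R G t) (hS : ∑ a, (S.inputs a).length ≤ E) (a : G)
    (ha : (S.vars a).card ≤ (K + 1) * t) :
    IsSumOfDisjointProducts t (E ^ K) (1 + K * E) (S.vars a) (S.val a) := by
  induction K generalizing S with
  | zero =>
    simpa using ((S.isMultilinearOn_val a).isDisjointProduct
      (by simpa using ha)).isSumOfDisjointProducts
  | succ K ih =>
    rcases le_or_gt (S.vars a).card t with hat | hat
    · exact ((S.isMultilinearOn_val a).isDisjointProduct hat).isSumOfDisjointProducts.mono
        (Nat.one_le_pow _ _ hE) (Nat.le_add_right _ _) subset_rfl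
    rw [S.val_eq_sum_pathCoeff_mul hat]
    -- Weighting `u` by its fan-in makes the total over `u` at most the number of edges, so a round
    -- costs one factor `E`.
    have hterm : ∀ u ∈ Finset.univ.filter (fun u => t < (S.vars u).card),
        IsSumOfDisjointProducts t (E ^ K * (S.inputs u).length) (1 + (K + 1) * E) (S.vars a)
          (S.pathCoeff u a * S.lightPart u) := by
      intro u hu
      replace hu : t < (S.vars u).card := by simpa using hu
      by_cases hua : S.Below u a
      · have h1 := ih (S.pathSystem u hu)
          ((Finset.sum_le_sum fun b _ => S.length_inputs_pathSystem_le hu b).trans hS) (by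
            rw [S.vars_pathSystem hu hua, Finset.card_sdiff_of_subset hua.vars_subset]
            have : (K + 1 + 1) * t = (K + 1) * t + t := by ring
            omega)
        rw [S.vars_pathSystem hu hua, S.val_pathSystem hu hua] at h1
        have hlen : (S.inputs u).length ≤ E :=
          (Finset.single_le_sum (f := fun b => (S.inputs b).length)
            (fun _ _ => Nat.zero_le _) (Finset.mem_univ u)).trans hS
        refine (h1.mul S.isSumOfDisjointProducts_lightPart Finset.sdiff_disjoint).mono le_rfl ?_ ?_
        · linarith
        · exact Finset.union_subset Finset.sdiff_subset hua.vars_subset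
      · rw [S.pathCoeff_eq_zero_of_not_below hua, zero_mul]
        exact isSumOfDisjointProducts_zero _ _ _ _
    refine (isSumOfDisjointProducts_sum hterm).mono ?_ le_rfl subset_rfl
    rw [← Finset.mul_sum, pow_succ]
    refine Nat.mul_le_mul_left _ (le_trans ?_ hS)
    exact Finset.sum_le_sum_of_subset (Finset.subset_univ _)

end MultilinearSystem

/-! ### The explicit depth-four formula -/

namespace DepthFour

variable {F : Type*} {n N M : ℕ}

/-- The gates of the depth-four formula for `∑ i, ∏ j, ∑ S ⊆ W i j, a i j S * ∏ x ∈ S, X x`, from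
the output down; the last summand holds the leaves, with `none` for the constant `a i j S`. -/
abbrev Gate (W : Fin N × Fin M → Finset (Fin n)) : Type :=
  Unit ⊕ Fin N ⊕ (Fin N × Fin M) ⊕ (Σ ij, (W ij).powerset) ⊕
    (Σ ij, Σ S : (W ij).powerset, Option S.1)

variable (W : Fin N × Fin M → Finset (Fin n))
  (a : Fin N × Fin M → Finset (Fin n) → F)

/-- The layer of a gate. -/
def layer : Gate W → ℕ
  | .inl _ => 4
  | .inr (.inl _) => 3
  | .inr (.inr (.inl _)) => 2
  | .inr (.inr (.inr (.inl _))) => 1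
  | .inr (.inr (.inr (.inr _))) => 0

/-- The label of a gate. -/
def label : Gate W → GateLabel F n
  | .inl _ => .add
  | .inr (.inl _) => .mul
  | .inr (.inr (.inl _)) => .add
  | .inr (.inr (.inr (.inl _))) => .mul
  | .inr (.inr (.inr (.inr ⟨ij, S, none⟩))) => .const (a ij S.1)
  | .inr (.inr (.inr (.inr ⟨_, _, some x⟩))) => .var x.1

/-- The gates wired into a gate. -/
noncomputable def inputs : Gate W → List (Gate W)
  | .inl _ => (Finset.univ : Finset (Fin N)).toList.map fun i => .inr (.inl i)
  | .inr (.inl i) =>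
    (Finset.univ : Finset (Fin M)).toList.map fun j => .inr (.inr (.inl (i, j)))
  | .inr (.inr (.inl ij)) =>
    (Finset.univ : Finset (W ij).powerset).toList.map fun S => .inr (.inr (.inr (.inl ⟨ij, S⟩)))
  | .inr (.inr (.inr (.inl ⟨ij, S⟩))) =>
    (Finset.univ : Finset (Option S.1)).toList.map
      fun x => .inr (.inr (.inr (.inr ⟨ij, S, x⟩)))
  | .inr (.inr (.inr (.inr _))) => []

theorem layer_of_mem_inputs {u v : Gate W} (h : u ∈ inputs W v) :
    layer W v = layer W u + 1 := by
  rcases v with v | v | v | ⟨ij, S⟩ | v <;> simp only [inputs, List.mem_map] at h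
  · obtain ⟨x, _, rfl⟩ := h; rfl
  · obtain ⟨x, _, rfl⟩ := h; rfl
  · obtain ⟨x, _, rfl⟩ := h; rfl
  · obtain ⟨x, _, rfl⟩ := h; rfl
  · simp at h

/-- The circuit of the formula `∑ i, ∏ j, ∑ S ⊆ W i j, a i j S * ∏ x ∈ S, X x`. -/
noncomputable def circuit (hN : 0 < N) (hM : 0 < M) : AlgCircuit F n where
  Gate := Gate W
  fintypeGate := inferInstance
  label := label W a
  inputs := inputs W
  inputs_eq_nil_iff g := by
    -- No internal gate may be without inputs: this needs positive `N` and `M`, the subset `∅` below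
    -- each inner sum, and the constant leaf below each monomial.
    have := Fin.pos_iff_nonempty.mp hN
    have := Fin.pos_iff_nonempty.mp hM
    have : ∀ ij, Nonempty (W ij).powerset := fun ij => ⟨⟨∅, by simp⟩⟩
    rcases g with v | v | v | ⟨ij, S⟩ | ⟨ij, S, _ | x⟩ <;>
      simp [inputs, label, GateLabel.IsLeaf, Finset.univ_eq_empty_iff, ← Finset.nonempty_iff_ne_empty,
        Finset.powerset_nonempty]
  acyclic g hg := by
    have : ∀ u v, Relation.TransGen (fun u v => u ∈ inputs W v) u v → layer W u < layer W v := by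
      intro u v h
      induction h with
      | single h => rw [layer_of_mem_inputs W h]; exact Nat.lt_succ_self _
      | tail _ h ih => exact ih.trans (by rw [layer_of_mem_inputs W h]; exact Nat.lt_succ_self _)
    exact lt_irrefl _ (this g g hg)

/-- The variables allowed below a gate. -/
def vars : Gate W → Set (Fin n)
  | .inl _ => Set.univ
  | .inr (.inl _) => Set.univ
  | .inr (.inr (.inl ij)) => W ij
  | .inr (.inr (.inr (.inl ⟨_, S⟩))) => S.1
  | .inr (.inr (.inr (.inr ⟨_, _, none⟩))) => ∅
  | .inr (.inr (.inr (.inr ⟨_, _, some x⟩))) => {x.1}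

variable (hN : 0 < N) (hM : 0 < M)

theorem subVars_subset (g : Gate W) : (circuit W a hN hM).subVars g ⊆ vars W g := by
  rintro i ⟨u, hu, hi⟩
  have hwire : ∀ u v : Gate W, u ∈ inputs W v → vars W u ⊆ vars W v := by
    intro u v h
    rcases v with v | v | v | ⟨ij, S⟩ | v <;> simp only [inputs, List.mem_map] at h
    · exact Set.subset_univ _
    · exact Set.subset_univ _
    · obtain ⟨x, _, rfl⟩ := h
      exact Finset.coe_subset.mpr (Finset.mem_powerset.mp x.2)
    · obtain ⟨_ | x, _, rfl⟩ := h
      · exact Set.empty_subset _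
      · exact Set.singleton_subset_iff.mpr x.2
    · simp at h
  have hmem : ∀ u : Gate W, label W a u = .var i → i ∈ vars W u := by
    intro u hi
    rcases u with v | v | v | v | ⟨ij, S, _ | x⟩ <;> simp only [label, reduceCtorEq] at hi
    exact (GateLabel.var.inj hi).symm
  replace hmem := hmem u hi
  clear hi
  induction hu with
  | refl => exact hmem
  | tail _ h ih => exact hwire _ _ h ih

theorem syntacticallyMultilinear
    (hW : ∀ i j j', j ≠ j' → Disjoint (W (i, j)) (W (i, j'))) :
    (circuit W a hN hM).SyntacticallyMultilinear := by
  suffices h : ∀ g : Gate W, label W a g = .mul →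
      (inputs W g).Pairwise fun u v => Disjoint (vars W u) (vars W v) from
    fun g hg => (h g hg).imp fun {u v} huv =>
      huv.mono (subVars_subset W a hN hM u) (subVars_subset W a hN hM v)
  intro g hg
  rcases g with v | i | v | ⟨ij, S⟩ | ⟨ij, S, _ | x⟩ <;> simp only [label, reduceCtorEq] at hg
  · simp only [inputs]
    rw [List.pairwise_map]
    refine (Finset.nodup_toList _).imp fun {j j'} h => ?_
    exact Finset.disjoint_coe.mpr (hW i j j' h)
  · simp only [inputs]
    rw [List.pairwise_map]
    refine (Finset.nodup_toList _).imp fun {x y} h => ?_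
    rcases x with _ | x
    · exact Set.empty_disjoint _
    rcases y with _ | y
    · exact Set.disjoint_empty _
    · refine Set.disjoint_singleton.mpr fun hxy => h ?_
      rw [Subtype.ext hxy]

theorem isSigmaPiSigmaPi : (circuit W a hN hM).IsSigmaPiSigmaPi := by
  have hleaf : ∀ g, (label W a g).IsLeaf → layer W g = 0 := by
    rintro (v | v | v | v | v) hg <;> first | rfl | exact False.elim hg
  have hmul : ∀ g, label W a g = .mul → layer W g = 1 ∨ layer W g = 3 := by
    rintro (v | v | v | v | ⟨ij, S, _ | x⟩) hg <;>
      first | exact Or.inl rfl | exact Or.inr rfl | exact nomatch hg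
  have hadd : ∀ g, label W a g = .add → layer W g = 2 ∨ layer W g = 4 := by
    rintro (v | v | v | v | ⟨ij, S, _ | x⟩) hg <;>
      first | exact Or.inl rfl | exact Or.inr rfl | exact nomatch hg
  refine ⟨layer W, hleaf, hmul, hadd, fun u v h => layer_of_mem_inputs W h, ?_⟩
  · intro g hg
    rcases g with v | i | ⟨i, j⟩ | ⟨ij, S⟩ | ⟨ij, S, x⟩
    · rfl
    · exact absurd (List.mem_map.mpr ⟨i, by simp, rfl⟩) (hg (.inl ()))
    · exact absurd (List.mem_map.mpr ⟨j, by simp, rfl⟩) (hg (.inr (.inl i)))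
    · exact absurd (List.mem_map.mpr ⟨S, by simp, rfl⟩) (hg (.inr (.inr (.inl ij))))
    · exact absurd (List.mem_map.mpr ⟨x, by simp, rfl⟩)
        (hg (.inr (.inr (.inr (.inl ⟨ij, S⟩)))))

theorem computes [CommSemiring F] :
    (circuit W a hN hM).Computes (∑ i, ∏ j, ∑ S ∈ (W (i, j)).powerset,
      C (a (i, j) S) * ∏ x ∈ S, X x) := by
  obtain ⟨val, hval⟩ : ∃ val : Gate W → MvPolynomial (Fin n) F,
    val = (circuit W a hN hM).value := ⟨_, rfl⟩
  have heq : ∀ g : Gate W, val g = match label W a g with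
      | .var i => X i
      | .const a => C a
      | .add => ((inputs W g).map val).sum
      | .mul => ((inputs W g).map val).prod := by
    rw [hval]
    exact (circuit W a hN hM).value_eq
  have h0 : ∀ ij S, val (.inr (.inr (.inr (.inl ⟨ij, S⟩)))) =
      C (a ij S.1) * ∏ x ∈ S.1, X x := by
    intro ij S
    rw [heq]
    simp only [label, inputs, List.map_map, Finset.prod_map_toList, Fintype.prod_option]
    congr 1
    · exact heq _
    · rw [← Finset.prod_coe_sort S.1 fun x => X x]
      exact Finset.prod_congr rfl fun x _ => heq _
  have h1 : ∀ ij, val (.inr (.inr (.inl ij))) =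
      ∑ S ∈ (W ij).powerset, C (a ij S) * ∏ x ∈ S, X x := by
    intro ij
    rw [heq]
    simp only [label, inputs, List.map_map, Finset.sum_map_toList]
    rw [← Finset.sum_coe_sort (W ij).powerset fun S => C (a ij S) * ∏ x ∈ S, X x]
    exact Finset.sum_congr rfl fun S _ => h0 ij S
  have h2 : ∀ i, val (.inr (.inl i)) =
      ∏ j, ∑ S ∈ (W (i, j)).powerset, C (a (i, j) S) * ∏ x ∈ S, X x := by
    intro i
    rw [heq]
    simp only [label, inputs, List.map_map, Finset.prod_map_toList]
    exact Finset.prod_congr rfl fun j _ => h1 (i, j)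
  refine ⟨.inl (), ?_, ?_⟩
  · intro v hv
    have := layer_of_mem_inputs W hv
    rcases v with v | v | v | v | v <;> simp [layer] at this
  · rw [← hval, heq]
    simp only [label, inputs, List.map_map, Finset.sum_map_toList]
    exact Finset.sum_congr rfl fun i _ => h2 i

/-- The four layers have at most `N`, `N * M`, `N * M * 2 ^ t` and `N * M * 2 ^ t * (t + 1)`
incoming edges, each monomial having one constant leaf besides its variables. -/
theorem size_le {t : ℕ} (ht : ∀ ij, (W ij).card ≤ t) :
    (circuit W a hN hM).size ≤ N * M * 2 ^ t * (t + 4) := by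
  have hpow : ∀ ij, (W ij).powerset.card ≤ 2 ^ t := fun ij => by
    rw [Finset.card_powerset]
    exact Nat.pow_le_pow_right two_pos (ht ij)
  have hsize : (circuit W a hN hM).size = ∑ g : Gate W, (inputs W g).length := rfl
  rw [hsize, Fintype.sum_sum_type, Fintype.sum_sum_type, Fintype.sum_sum_type,
    Fintype.sum_sum_type]
  simp only [inputs, List.length_map, Finset.length_toList, Finset.card_univ, Fintype.card_fin,
    Fintype.card_coe, Fintype.card_option, List.length_nil, Finset.sum_const_zero, add_zero,
    Finset.sum_const, smul_eq_mul, Fintype.card_unit, one_mul, Fintype.sum_sigma]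
  have h2 : ∑ ij : Fin N × Fin M, (W ij).powerset.card ≤ N * M * 2 ^ t := by
    refine (Finset.sum_le_card_nsmul _ _ _ fun ij _ => hpow ij).trans ?_
    simp
  have h1 : ∑ ij : Fin N × Fin M, ∑ S : (W ij).powerset, (S.1.card + 1) ≤
      N * M * (2 ^ t * (t + 1)) := by
    refine (Finset.sum_le_card_nsmul _ _ (2 ^ t * (t + 1)) fun ij _ => ?_).trans (by simp)
    refine (Finset.sum_le_card_nsmul _ _ (t + 1) fun S _ => ?_).trans ?_
    · have := (Finset.card_le_card (Finset.mem_powerset.mp S.2)).trans (ht ij)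
      omega
    · simpa using Nat.mul_le_mul_right (t + 1) (hpow ij)
  have h3 : N ≤ N * M := Nat.le_mul_of_pos_right _ hM
  have h4 : N * M ≤ N * M * 2 ^ t := Nat.le_mul_of_pos_right _ (by positivity)
  nlinarith [h1, h2, h3, h4]

end DepthFour

/-! ### Padding to a rectangular formula -/

section Families

variable {σ R : Type*} [DecidableEq σ] [CommSemiring R] {t N M : ℕ} {W : Finset σ}
  {p : MvPolynomial σ R}

theorem IsDisjointProduct.exists_family (h : IsDisjointProduct t M W p) :
    ∃ (V : Fin M → Finset σ) (q : Fin M → MvPolynomial σ R), (∀ j, (V j).card ≤ t) ∧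
      (∀ j, IsMultilinearOn (V j) (q j)) ∧ (∀ j j', j ≠ j' → Disjoint (V j) (V j')) ∧
      ∏ j, q j = p := by
  obtain ⟨l, h1, h2, h3, rfl⟩ := h
  -- Factors 1 on the empty set of variables bring the length to exactly `M`.
  obtain ⟨l', hl'⟩ : ∃ l', l' = l ++ List.replicate (M - l.length)
    ((∅, 1) : Finset σ × MvPolynomial σ R) := ⟨_, rfl⟩
  have hlen : l'.length = M := by simp [hl', h1]
  have hprod : (l'.map Prod.snd).prod = (l.map Prod.snd).prod := by simp [hl']
  have hmem : ∀ x ∈ l', x.1.card ≤ t ∧ IsMultilinearOn x.1 x.2 := by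
    intro x hx
    rw [hl', List.mem_append] at hx
    rcases hx with hx | hx
    · exact ⟨(h3 x hx).1, (h3 x hx).2.2⟩
    · rw [(List.mem_replicate.mp hx).2]
      exact ⟨by simp, isMultilinearOn_one _⟩
  have hpair : l'.Pairwise fun x y => Disjoint x.1 y.1 := by
    rw [hl', List.pairwise_append]
    refine ⟨h2, ?_, ?_⟩
    · rw [List.pairwise_replicate]
      simp
    · intro x _ y hy
      rw [(List.mem_replicate.mp hy).2]
      simp
  subst hlen
  refine ⟨fun j => l'[j].1, fun j => l'[j].2, fun j => (hmem _ (List.getElem_mem _)).1,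
    fun j => (hmem _ (List.getElem_mem _)).2, ?_, ?_⟩
  · intro j j' hj
    rw [List.pairwise_iff_getElem] at hpair
    rcases lt_or_gt_of_ne (Fin.val_ne_of_ne hj) with hlt | hlt
    · exact hpair _ _ _ _ hlt
    · exact (hpair _ _ _ _ hlt).symm
  · rw [← hprod]
    exact Fin.prod_univ_fun_getElem l' Prod.snd

theorem IsSumOfDisjointProducts.exists_family (h : IsSumOfDisjointProducts t N M W p)
    (hM : 0 < M) : ∃ q : Fin N → MvPolynomial σ R,
      (∀ i, IsDisjointProduct t M W (q i)) ∧ ∑ i, q i = p := by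
  obtain ⟨L, h1, h2, rfl⟩ := h
  obtain ⟨L', hL'⟩ : ∃ L', L' = L ++ List.replicate (N - L.length) (0 : MvPolynomial σ R) :=
    ⟨_, rfl⟩
  have hlen : L'.length = N := by simp [hL', h1]
  have hsum : L'.sum = L.sum := by simp [hL']
  have hmem : ∀ x ∈ L', IsDisjointProduct t M W x := by
    intro x hx
    rw [hL', List.mem_append] at hx
    rcases hx with hx | hx
    · exact h2 x hx
    · rw [(List.mem_replicate.mp hx).2]
      -- The padding summand 0 is a product with a single factor, hence the need for `0 < M`.
      exact ((isMultilinearOn_zero ∅).isDisjointProduct (by simp)).mono hM (Finset.empty_subset _)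
  subst hlen
  exact ⟨fun i => L'[i], fun i => hmem _ (List.getElem_mem _), by
    rw [← hsum]; exact Fin.sum_univ_getElem L'⟩

end Families

theorem IsSumOfDisjointProducts.exists_circuit {F : Type*} [CommSemiring F] {n t N M : ℕ}
    {W : Finset (Fin n)} {p : MvPolynomial (Fin n) F} (h : IsSumOfDisjointProducts t N M W p)
    (hN : 0 < N) (hM : 0 < M) :
    ∃ D : AlgCircuit F n, D.IsSigmaPiSigmaPi ∧ D.SyntacticallyMultilinear ∧ D.Computes p ∧
      D.size ≤ N * M * 2 ^ t * (t + 4) := by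
  obtain ⟨P, hP, rfl⟩ := h.exists_family hM
  choose V q hV hq hd hprod using fun i => (hP i).exists_family
  refine ⟨DepthFour.circuit (fun ij => V ij.1 ij.2)
    (fun ij S => coeff (∑ i ∈ S, Finsupp.single i 1) (q ij.1 ij.2)) hN hM,
    DepthFour.isSigmaPiSigmaPi _ _ _ _,
    DepthFour.syntacticallyMultilinear _ _ _ _ fun i j j' => hd i j j', ?_,
    DepthFour.size_le _ _ _ _ fun ij => hV ij.1 ij.2⟩
  convert DepthFour.computes _ _ hN hM using 1
  refine Finset.sum_congr rfl fun i _ => ?_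
  rw [← hprod i]
  exact Finset.prod_congr rfl fun j _ => (hq i j).eq_sum_powerset

/-! ### Depth reduction for circuits -/

namespace AlgCircuit

variable {F : Type*} {n : ℕ} (C : AlgCircuit F n)

theorem Wire.subVars_subset {C : AlgCircuit F n} {u v : C.Gate} (h : C.Wire u v) :
    C.subVars u ⊆ C.subVars v := by
  rintro i ⟨w, hw, hi⟩
  exact ⟨w, hw.tail h, hi⟩

/-- The number of gates strictly below a gate. -/
noncomputable def rank (g : C.Gate) : ℕ := {h | Relation.TransGen C.Wire h g}.ncard

theorem Wire.rank_lt {C : AlgCircuit F n} {u v : C.Gate} (h : C.Wire u v) :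
    C.rank u < C.rank v := by
  refine Set.ncard_lt_ncard ⟨fun w hw => Relation.TransGen.tail hw h, fun hsub => ?_⟩
    (Set.toFinite _)
  exact C.acyclic u (hsub (Relation.TransGen.single h))

theorem eq_of_reflTransGen_of_isLeaf {u g : C.Gate} (hg : (C.label g).IsLeaf)
    (h : Relation.ReflTransGen C.Wire u g) : u = g := by
  rcases h.cases_tail with h | ⟨w, _, hw⟩
  · exact h.symm
  · have hw' : w ∈ C.inputs g := hw
    simp [(C.inputs_eq_nil_iff g).mpr hg] at hw'

variable [CommSemiring F]

open Classical in
/-- A syntactically multilinear circuit as a `MultilinearSystem`. -/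
noncomputable def toMultilinearSystem (hC : C.SyntacticallyMultilinear) {t : ℕ} (ht : 1 ≤ t) :
    MultilinearSystem (Fin n) F C.Gate t where
  kind g := match C.label g with
    | .var _ => .leaf
    | .const _ => .leaf
    | .add => .sum
    | .mul => .prod
  inputs := C.inputs
  val := C.value
  vars g := (C.subVars g).toFinset
  rank := C.rank
  rank_lt _ _ h := Wire.rank_lt h
  vars_subset _ _ h := Set.toFinset_subset_toFinset.mpr (Wire.subVars_subset h)
  card_leaf g hg := by
    have hleaf : (C.label g).IsLeaf := by
      revert hg; cases C.label g <;> simp [GateLabel.IsLeaf]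
    -- A leaf may carry one variable, which is why `1 ≤ t` is required.
    refine le_trans (Finset.card_le_one.mpr fun i hi j hj => ?_) ht
    obtain ⟨u, hu, hi⟩ := Set.mem_toFinset.mp hi
    obtain ⟨v, hv, hj⟩ := Set.mem_toFinset.mp hj
    rw [C.eq_of_reflTransGen_of_isLeaf hleaf hu] at hi
    rw [C.eq_of_reflTransGen_of_isLeaf hleaf hv, hi] at hj
    exact GateLabel.var.inj hj
  val_leaf g hg := by
    rw [C.value_eq g]
    cases h : C.label g with
    | var i =>
      exact isMultilinearOn_X (Set.mem_toFinset.mpr ⟨g, Relation.ReflTransGen.refl, h⟩)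
    | const a => exact isMultilinearOn_C _ a
    | add => simp [h] at hg
    | mul => simp [h] at hg
  val_sum g hg := by
    rw [C.value_eq g]
    cases h : C.label g <;> simp [h] at hg
    rfl
  val_prod g hg := by
    rw [C.value_eq g]
    cases h : C.label g <;> simp [h] at hg
    rfl
  inputs_ne_nil g hg hnil := by
    have := (C.inputs_eq_nil_iff g).mp hnil
    cases h : C.label g <;> simp_all [GateLabel.IsLeaf]
  disjoint g hg := by
    have h : C.label g = .mul := by
      cases h : C.label g <;> simp [h] at hg
      rfl
    exact (hC g h).imp fun {u v} huv => Set.disjoint_toFinset.mpr huv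

/-- Depth reduction: a syntactically multilinear circuit in `n ≤ (K + 1) t` variables with at most
`E` edges can be turned into a syntactically multilinear `ΣΠΣΠ` circuit with roughly `E ^ K * 2 ^ t`
edges. -/
theorem exists_sigmaPiSigmaPi (hC : C.SyntacticallyMultilinear) {p : MvPolynomial (Fin n) F}
    (hp : C.Computes p) {E K t : ℕ} (hE : 1 ≤ E) (hsize : C.size ≤ E) (ht : 1 ≤ t)
    (hn : n ≤ (K + 1) * t) :
    ∃ D : AlgCircuit F n, D.IsSigmaPiSigmaPi ∧ D.SyntacticallyMultilinear ∧ D.Computes p ∧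
      D.size ≤ E ^ K * (1 + K * E) * 2 ^ t * (t + 4) := by
  classical
  obtain ⟨g, _, rfl⟩ := hp
  refine (MultilinearSystem.isSumOfDisjointProducts_val hE K (C.toMultilinearSystem hC ht) hsize g
    ?_).exists_circuit (pow_pos hE K) (by omega)
  exact (Finset.card_le_univ _).trans (by simpa using hn)

end AlgCircuit

/-! ### Choice of parameters -/

open Filter in
-- With `t = ⌈√(n log n)⌉` and `K = n / t`, both `K * log n` and `log n` are at most `t`, so every
-- factor of the size is `exp (O(t))`.
theorem eventually_depthFour_size_lt {d : ℕ → ℕ}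
    (hd : (fun n : ℕ => (n : ℝ) / Real.log n) =o[atTop] fun n : ℕ => (d n : ℝ))
    {c : ℝ} (hc : 0 < c) (k : ℕ) :
    ∀ᶠ n : ℕ in atTop, ∃ K t : ℕ, 1 ≤ t ∧ n ≤ (K + 1) * t ∧
      (((n ^ k) ^ K * (1 + K * n ^ k) * 2 ^ t * (t + 4) : ℕ) : ℝ) <
        (n : ℝ) ^ (c * Real.sqrt (d n)) := by
  -- The four factors have exponents `k`, `k + 2`, `1` and `4` times `t`, in total `A / 2 * t`; as
  -- `t ≤ 2 * r`, this is at most `A * r`.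
  set A : ℝ := 4 * k + 14 with hA
  have hApos : 0 < A := by positivity
  -- This constant gives `A * r ≤ (c / 2) * √d * log n`; the spare factor 2 makes the final
  -- inequality strict.
  have hε : 0 < (c / (2 * A)) ^ 2 := by positivity
  filter_upwards [hd.bound hε, eventually_ge_atTop 3] with n hn hn3
  have hn3' : (3 : ℝ) ≤ n := by exact_mod_cast hn3
  have hn0 : (0 : ℝ) < n := by linarith
  set L := Real.log n with hL
  have hL1 : 1 ≤ L := by
    rw [hL, Real.le_log_iff_exp_le hn0]
    exact Real.exp_one_lt_three.le.trans hn3'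
  have hLn : L ≤ n := (Real.log_le_sub_one_of_pos hn0).trans (by linarith)
  set r := Real.sqrt (n * L) with hr
  have hr2 : r ^ 2 = n * L := Real.sq_sqrt (by positivity)
  have hr0 : 0 ≤ r := Real.sqrt_nonneg _
  have hLr : L ≤ r := Real.le_sqrt_of_sq_le (by nlinarith)
  set t := ⌈r⌉₊ with ht
  have hrt : r ≤ t := Nat.le_ceil r
  have htr : (t : ℝ) < r + 1 := Nat.ceil_lt_add_one hr0
  have ht1 : 1 ≤ t := Nat.one_le_ceil_iff.mpr (by linarith)
  have hLt : L ≤ t := hLr.trans hrt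
  refine ⟨n / t, t, ht1, ?_, ?_⟩
  · rw [mul_comm]
    exact (Nat.lt_mul_div_succ n ht1).le
  have hKL : ((n / t : ℕ) : ℝ) * L ≤ t := by
    have ht0 : (0 : ℝ) < t := by exact_mod_cast ht1
    calc ((n / t : ℕ) : ℝ) * L ≤ (n / t : ℝ) * L := by
          gcongr; exact Nat.cast_div_le
      _ = n * L / t := by ring
      _ ≤ t := by
          rw [div_le_iff₀ ht0, ← hr2]
          nlinarith
  set K := n / t
  have hnexp : (n : ℝ) = Real.exp L := (Real.exp_log hn0).symm
  have h1 : (((n : ℝ) ^ k) ^ K) ≤ Real.exp (k * t) := by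
    rw [hnexp, ← Real.exp_nat_mul, ← Real.exp_nat_mul]
    refine Real.exp_le_exp.mpr ?_
    calc (K : ℝ) * (k * L) = k * (K * L) := by ring
      _ ≤ k * t := by gcongr
  have h2 : 1 + (K : ℝ) * n ^ k ≤ Real.exp ((k + 2) * t) := by
    have hKn : (K : ℝ) ≤ n := by exact_mod_cast Nat.div_le_self n t
    calc 1 + (K : ℝ) * n ^ k ≤ n ^ k * n ^ 1 + n * n ^ k := by
          gcongr
          rw [← pow_add]
          exact one_le_pow₀ (by linarith)
      _ = 2 * (n ^ k * n) := by ring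
      _ ≤ n * (n ^ k * n) := by gcongr; linarith
      _ = n ^ (k + 2) := by ring
      _ = Real.exp ((k + 2 : ℕ) * L) := by rw [Real.exp_nat_mul, ← hnexp]
      _ ≤ Real.exp ((k + 2) * t) := by
          push_cast
          gcongr
  have h3 : (2 : ℝ) ^ t ≤ Real.exp t := by
    have : (2 : ℝ) ≤ Real.exp 1 := by linarith [Real.add_one_le_exp (1 : ℝ)]
    calc (2 : ℝ) ^ t ≤ Real.exp 1 ^ t := by gcongr
      _ = Real.exp t := by rw [← Real.exp_nat_mul, mul_one]
  have h4 : (t : ℝ) + 4 ≤ Real.exp (4 * t) := by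
    have : (1 : ℝ) ≤ t := by exact_mod_cast ht1
    linarith [Real.add_one_le_exp (4 * (t : ℝ))]
  have h5 : (((n ^ k) ^ K * (1 + K * n ^ k) * 2 ^ t * (t + 4) : ℕ) : ℝ) ≤ Real.exp (A / 2 * t) := by
    push_cast
    calc ((n : ℝ) ^ k) ^ K * (1 + K * n ^ k) * 2 ^ t * (t + 4)
        ≤ Real.exp (k * t) * Real.exp ((k + 2) * t) * Real.exp t * Real.exp (4 * t) := by gcongr
      _ = Real.exp (A / 2 * t) := by
          rw [← Real.exp_add, ← Real.exp_add, ← Real.exp_add]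
          congr 1
          rw [hA]; ring
  have h6 : A / 2 * t ≤ A * r := by nlinarith
  have hdpos : (n : ℝ) / L ≤ (c / (2 * A)) ^ 2 * d n := by
    have : 0 ≤ (n : ℝ) / L := by positivity
    simpa [Real.norm_of_nonneg this] using hn
  have h7 : r ≤ c / (2 * A) * (Real.sqrt (d n) * L) := by
    refine Real.sqrt_le_iff.mpr ⟨by positivity, ?_⟩
    -- Multiplying by `L ^ 2` turns `n / L` into `n * L = r ^ 2`.
    have h := mul_le_mul_of_nonneg_right hdpos (sq_nonneg L)
    have e : (n : ℝ) / L * L ^ 2 = n * L := by field_simp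
    rw [mul_pow, mul_pow, Real.sq_sqrt (Nat.cast_nonneg _)]
    linarith
  have h8 : A * r ≤ c / 2 * (Real.sqrt (d n) * L) := by
    calc A * r ≤ A * (c / (2 * A) * (Real.sqrt (d n) * L)) := by gcongr
      _ = c / 2 * (Real.sqrt (d n) * L) := by field_simp
  have h9 : 0 < A * r := mul_pos hApos (by linarith)
  refine h5.trans_lt ?_
  rw [Real.rpow_def_of_pos hn0]
  refine Real.exp_lt_exp.mpr ?_
  have e : L * (c * Real.sqrt (d n)) = 2 * (c / 2 * (Real.sqrt (d n) * L)) := by ring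
  rw [e]
  linarith

theorem corollary1p8 {F : Type*} [Field F]
    (f : (n : ℕ) → MvPolynomial (Fin n) F)
    (hmultilinear : ∀ (n : ℕ) (i : Fin n), (f n).degreeOf i ≤ 1)
    (hdegree : (fun n : ℕ => (n : ℝ) / Real.log n) =o[Filter.atTop]
      (fun n : ℕ => ((f n).totalDegree : ℝ)))
    (hdepth4 : ∃ c : ℝ, 0 < c ∧ ∀ᶠ n : ℕ in Filter.atTop, ∀ C : AlgCircuit F n,
      C.IsSigmaPiSigmaPi → C.SyntacticallyMultilinear → C.Computes (f n) →
        (n : ℝ) ^ (c * Real.sqrt ((f n).totalDegree : ℝ)) ≤ (C.size : ℝ)) :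
    ∀ k : ℕ, ∀ᶠ n : ℕ in Filter.atTop, ∀ C : AlgCircuit F n,
      C.SyntacticallyMultilinear → C.Computes (f n) → n ^ k < C.size := by
  intro k
  obtain ⟨c, hc, hlow⟩ := hdepth4
  filter_upwards [hlow, eventually_depthFour_size_lt hdegree hc k,
    Filter.eventually_ge_atTop 1] with n hlow ⟨K, t, ht, hn, hlt⟩ hn1 C hC hp
  by_contra! hsize
  obtain ⟨D, hD, hDm, hDp, hDs⟩ :=
    C.exists_sigmaPiSigmaPi hC hp (Nat.one_le_pow k n hn1) hsize ht hn
  exact absurd ((hlow D hD hDm hDp).trans (Nat.cast_le.mpr hDs)) hlt.not_ge
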